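/- Let $p$ be a prime number, let $q=p^d$ with $d\ge 1$, and let $G$ be a profinite group. Subgroups are closed and homomorphisms are continuous. For a profinite group $A$ and a normal subgroup $N$ of $A$, write $N^q[N,A]$ for the closed subgroup of $A$ topologically generated by all powers $h^q$ and all commutators $[h,a]=h^{-1}a^{-1}ha$ with $h\in N$, $a\in A$. Write $H^r(A)=H^r(A,\mathbb{Z}/q)$ for the continuous cohomology with trivial action on $\mathbb{Z}/q$, and $H^1(N)^A$ for the group of all continuous homomorphisms $\psi:N\to\mathbb{Z}/q$ such that $\psi(a^{-1}na)=\psi(n)$ for all $a\in A$, $n\in N$. Let $G(p)$ be the maximal pro-$p$ quotient of $G$, let $G^{(2)}=G^q[G,G]$ and $G^{[2]}=G/G^{(2)}$, and let $\varphi:G(p)\to G^{[2]}$ be the natural map. **Theorem 7.1.** Let $S$ be a free pro-$p$ group (of any rank, on a basis converging to $1$) and let $\pi:S\to G(p)$ be an epimorphism. Put $R=\ker(\pi)$ and $T=\ker(\varphi\circ\pi)$, so that $R\le T$. Then the following conditions are equivalent: (a) the inflation map $H^2(G^{[2]})\to H^2(G(p))$ along $\varphi$ is surjective; (b) the restriction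 map $H^1(T)^S\to H^1(R)^S$ is surjective; (c) the homomorphism $R/R^q[R,S]\to T/T^q[T,S]$ induced by the inclusion $R\le T$ is injective; (d) $R^q[R,S]=R\cap T^q[T,S]$. -/

import Mathlib

open CategoryTheory

universe u v

namespace QCentral

/-! ### Closed subgroups of the form `N^q [N, G]` and the descending `q`-central sequence -/

section PowComm

variable {G : Type u} [Group G]

/-- The powers `h ^ q` and the commutators `[h, g] = h⁻¹ g⁻¹ h g`, with `h ∈ N` and `g ∈ G`. -/
def powCommSet (q : ℕ) (N : Subgroup G) : Set G :=
  {x | ∃ h ∈ N, x = h ^ q} ∪ {x | ∃ h ∈ N, ∃ g : G, x = h⁻¹ * g⁻¹ * h * g}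

theorem powCommSet_mono (q : ℕ) {M N : Subgroup G} (h : M ≤ N) :
    powCommSet q M ⊆ powCommSet q N := by
  rintro x (⟨m, hm, rfl⟩ | ⟨m, hm, g, rfl⟩)
  · exact Or.inl ⟨m, h hm, rfl⟩
  · exact Or.inr ⟨m, h hm, g, rfl⟩

theorem conj_mem_powCommSet (q : ℕ) {N : Subgroup G} (hN : N.Normal) (a : G) {x : G}
    (hx : x ∈ powCommSet q N) : a * x * a⁻¹ ∈ powCommSet q N := by
  rcases hx with ⟨m, hm, rfl⟩ | ⟨m, hm, g, rfl⟩
  · exact Or.inl ⟨a * m * a⁻¹, hN.conj_mem m hm a, by rw [conj_pow]⟩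
  · exact Or.inr ⟨a * m * a⁻¹, hN.conj_mem m hm a, a * g * a⁻¹, by group⟩

variable [TopologicalSpace G] [IsTopologicalGroup G]

/-- `N^q [N, G]`: the closed subgroup of `G` topologically generated by all powers `h ^ q` and all
commutators `[h, g]`, with `h ∈ N` and `g ∈ G`. -/
def powComm (q : ℕ) (N : Subgroup G) : Subgroup G :=
  (Subgroup.closure (powCommSet q N)).topologicalClosure

theorem powComm_mono (q : ℕ) {M N : Subgroup G} (h : M ≤ N) : powComm q M ≤ powComm q N :=
  Subgroup.topologicalClosure_mono (Subgroup.closure_mono (powCommSet_mono q h))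

instance powComm_normal (q : ℕ) (N : Subgroup G) [hN : N.Normal] : (powComm q N).Normal := by
  have h : (Subgroup.closure (powCommSet q N)).Normal := by
    refine ⟨fun n hn a => ?_⟩
    induction hn using Subgroup.closure_induction with
    | mem x hx => exact Subgroup.subset_closure (conj_mem_powCommSet q hN a hx)
    | one => simp
    | mul x y _ _ hx hy =>
      have e : a * (x * y) * a⁻¹ = (a * x * a⁻¹) * (a * y * a⁻¹) := by group
      rw [e]
      exact mul_mem hx hy
    | inv x _ hx =>
      have e : a * x⁻¹ * a⁻¹ = (a * x * a⁻¹)⁻¹ := by group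
      rw [e]
      exact inv_mem hx
  exact Subgroup.is_normal_topologicalClosure _

variable (G)

/-- The descending `q`-central sequence `G^(1) = G`, `G^(i+1) = (G^(i))^q [G^(i), G]`.
The index starts at `1`; the value at `0` is a dummy. -/
def qCentral (q : ℕ) : ℕ → Subgroup G
  | 0 => ⊤
  | 1 => ⊤
  | i + 2 => powComm q (qCentral q (i + 1))

instance qCentral_normal (q : ℕ) : ∀ i : ℕ, (qCentral G q i).Normal
  | 0 => (inferInstance : (⊤ : Subgroup G).Normal)
  | 1 => (inferInstance : (⊤ : Subgroup G).Normal)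
  | i + 2 =>
    haveI := qCentral_normal q (i + 1)
    (inferInstance : (powComm q (qCentral G q (i + 1))).Normal)

/-- The quotient `G^[i] = G / G^(i)`, with the quotient topology. -/
abbrev QCentralQuotient (q i : ℕ) : Type u := G ⧸ qCentral G q i

end PowComm

/-! ### Pro-`p` groups, maximal pro-`p` quotients and free pro-`p` groups -/

section ProP

/-- A profinite group is pro-`p` if its quotients by open normal subgroups, which are finite, are
all `p`-groups. -/
def IsProP (p : ℕ) (G : Type u) [Group G] [TopologicalSpace G] : Prop :=
  ∀ U : OpenNormalSubgroup G, IsPGroup p (G ⧸ U.toSubgroup)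

/-- A map from a set (with no topology) to a topological group converges to `1` if every open
neighbourhood of `1` contains the images of all but finitely many elements. -/
def ConvergesToOne {X : Type v} {P : Type u} [Group P] [TopologicalSpace P] (f : X → P) : Prop :=
  ∀ W : Set P, IsOpen W → (1 : P) ∈ W → {x | f x ∉ W}.Finite

/-- `S` is a free pro-`p` group: a pro-`p` group with a basis `X`, that is, a subset `X` of `S`
converging to `1` such that every map from `X` to a pro-`p` group that converges to `1` extends
uniquely to a continuous homomorphism on `S`. -/
def IsFreeProP (p : ℕ) (S : Type u) [Group S] [TopologicalSpace S] : Prop :=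
  IsProP p S ∧
    ∃ X : Set S, ConvergesToOne (fun x : X => (x : S)) ∧
      ∀ (P : Type u) [Group P] [TopologicalSpace P] [IsTopologicalGroup P] [CompactSpace P]
        [TotallyDisconnectedSpace P], IsProP p P →
        ∀ f : X → P, ConvergesToOne f → ∃! F : S →ₜ* P, ∀ x : X, F x = f x

variable (p : ℕ) (G : Type u) [Group G] [TopologicalSpace G]

/-- The kernel of `G → G(p)`: the intersection of all open normal subgroups `U` of `G` such that
`G / U` is a `p`-group. -/
def proPKernel : Subgroup G :=
  ⨅ U : {U : OpenNormalSubgroup G // IsPGroup p (G ⧸ U.toSubgroup)}, U.1.toSubgroup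

instance proPKernel_normal : (proPKernel p G).Normal :=
  Subgroup.normal_iInf_normal fun U => U.1.isNormal'

/-- The maximal pro-`p` quotient `G(p)` of a profinite group `G`, with the quotient topology. -/
abbrev MaxProPQuotient : Type u := G ⧸ proPKernel p G

/-- Every closed normal subgroup `N` of the profinite group `G` such that `G / N` is killed by a
power of `p` contains the kernel of `G → G(p)`. -/
theorem proPKernel_le [IsTopologicalGroup G] [CompactSpace G] [TotallyDisconnectedSpace G]
    (d : ℕ) (N : Subgroup G) [N.Normal] (hc : IsClosed (N : Set G))
    (hN : ∀ g : G, g ^ p ^ d ∈ N) : proPKernel p G ≤ N := by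
  have h := ProfiniteGrp.closedSubgroup_eq_sInf_open (⟨N, hc⟩ : ClosedSubgroup G)
  intro x hx
  by_contra hxN
  let W : Set G := {y | x * y ∈ N}ᶜ
  have hW : IsOpen W := (hc.preimage (continuous_const_mul x)).isOpen_compl
  have h1 : (1 : G) ∈ W := by
    change ¬ (x * 1 ∈ N)
    simpa using hxN
  obtain ⟨V, hV⟩ := ProfiniteGrp.exist_openNormalSubgroup_sub_open_nhds_of_one hW h1
  let U : OpenNormalSubgroup G :=
    { toSubgroup := V.toSubgroup ⊔ N
      isOpen' := Subgroup.isOpen_mono le_sup_left V.isOpen'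
      isNormal' := Subgroup.sup_normal _ _ }
  have hU : IsPGroup p (G ⧸ U.toSubgroup) := by
    intro g
    obtain ⟨g, rfl⟩ := QuotientGroup.mk_surjective g
    refine ⟨d, ?_⟩
    rw [← QuotientGroup.mk_pow, QuotientGroup.eq_one_iff]
    exact (le_sup_right : N ≤ V.toSubgroup ⊔ N) (hN g)
  have hxU : x ∈ V.toSubgroup ⊔ N := (Subgroup.mem_iInf.1 hx) ⟨U, hU⟩
  obtain ⟨a, ha, n, hn, rfl⟩ := Subgroup.mem_sup_of_normal_right.1 hxU
  have ha' : n⁻¹ * a⁻¹ * n ∈ V.toSubgroup := by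
    simpa using V.isNormal'.conj_mem a⁻¹ (inv_mem ha) n⁻¹
  refine hV ha' ?_
  have e : a * n * (n⁻¹ * a⁻¹ * n) = n := by group
  change a * n * (n⁻¹ * a⁻¹ * n) ∈ N
  rw [e]
  exact hn

/-- The natural map `φ : G(p) → G^[2]`, where `q = p ^ d`. -/
def phi [IsTopologicalGroup G] [CompactSpace G] [TotallyDisconnectedSpace G] (d : ℕ) :
    MaxProPQuotient p G →ₜ* QCentralQuotient G (p ^ d) 2 where
  toMonoidHom := QuotientGroup.map (proPKernel p G) (qCentral G (p ^ d) 2) (MonoidHom.id G)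
    (proPKernel_le p G d (qCentral G (p ^ d) 2) (Subgroup.isClosed_topologicalClosure _)
      fun g => Subgroup.le_topologicalClosure _
        (Subgroup.subset_closure (Or.inl ⟨g, Subgroup.mem_top g, rfl⟩)))
  continuous_toFun := (QuotientGroup.isQuotientMap_mk (N := proPKernel p G)).continuous_iff.2
    (QuotientGroup.continuous_mk (N := qCentral G (p ^ d) 2))

@[simp]
theorem phi_mk [IsTopologicalGroup G] [CompactSpace G] [TotallyDisconnectedSpace G] (d : ℕ)
    (g : G) : phi p G d (g : MaxProPQuotient p G) = (g : QCentralQuotient G (p ^ d) 2) :=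
  rfl

variable {S : Type v} [Group S] [TopologicalSpace S]

/-- The kernel `R` of `π : S → G(p)`. -/
abbrev kerR {p : ℕ} {G : Type u} [Group G] [TopologicalSpace G] (π : S →ₜ* MaxProPQuotient p G) :
    Subgroup S :=
  π.toMonoidHom.ker

/-- The kernel `T` of the composed map `φ ∘ π : S → G^[2]`, where `q = p ^ d`. -/
abbrev kerT {p : ℕ} {G : Type u} [Group G] [TopologicalSpace G] [IsTopologicalGroup G]
    [CompactSpace G] [TotallyDisconnectedSpace G] (d : ℕ) (π : S →ₜ* MaxProPQuotient p G) :
    Subgroup S :=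
  ((phi p G d).comp π).toMonoidHom.ker

theorem kerR_le_kerT {p : ℕ} {G : Type u} [Group G] [TopologicalSpace G] [IsTopologicalGroup G]
    [CompactSpace G] [TotallyDisconnectedSpace G] (d : ℕ) (π : S →ₜ* MaxProPQuotient p G) :
    kerR π ≤ kerT d π := by
  intro s hs
  have h : π s = 1 := hs
  change phi p G d (π s) = 1
  rw [h, map_one]

end ProP

/-! ### Invariant classes in `H¹` of a normal subgroup, and restriction -/

section H1

variable {S : Type u} [Group S] [TopologicalSpace S] [IsTopologicalGroup S]

/-- `H¹(N)^S` for a normal subgroup `N` of `S`: as `N` acts trivially on `ℤ/q`, `H¹(N)` is the group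
of continuous homomorphisms `ψ : N → ℤ/q`, and `s ∈ S` acts on it by `ψ^s(n) = ψ(s⁻¹ n s)`.
(The additive group `ℤ/q` is written multiplicatively.) -/
def H1Inv (q : ℕ) (N : Subgroup S) [hN : N.Normal] :
    Subgroup (N →ₜ* Multiplicative (ZMod q)) where
  carrier := {ψ | ∀ (s : S) (n : N),
    ψ ⟨s⁻¹ * n * s, by simpa using hN.conj_mem n n.2 s⁻¹⟩ = ψ n}
  one_mem' _ _ := rfl
  mul_mem' {a b} ha hb s n := congrArg₂ (· * ·) (ha s n) (hb s n)
  inv_mem' {a} ha s n := congrArg (·⁻¹) (ha s n)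

/-- The inclusion of a subgroup into a larger one, as a continuous homomorphism. -/
def inclusionHom {R T : Subgroup S} (h : R ≤ T) : R →ₜ* T where
  toMonoidHom := Subgroup.inclusion h
  continuous_toFun := continuous_inclusion h

/-- The restriction map `H¹(T)^S → H¹(R)^S` for normal subgroups `R ≤ T` of `S`. -/
def resH1 (q : ℕ) {R T : Subgroup S} [R.Normal] [T.Normal] (h : R ≤ T) :
    H1Inv q T →* H1Inv q R where
  toFun ψ := ⟨(ψ : T →ₜ* Multiplicative (ZMod q)).comp (inclusionHom h),
    fun s n => ψ.2 s (inclusionHom h n)⟩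
  map_one' := rfl
  map_mul' _ _ := rfl

/-- The homomorphism `R / R^q[R, S] → T / T^q[T, S]` induced by the inclusion `R ≤ T`. -/
def powCommQuotientMap (q : ℕ) {R T : Subgroup S} [R.Normal] [T.Normal] (h : R ≤ T) :
    R ⧸ (powComm q R).subgroupOf R →* T ⧸ (powComm q T).subgroupOf T :=
  QuotientGroup.map _ _ (Subgroup.inclusion h) fun _ hr => powComm_mono q h hr

end H1

/-! ### The second cohomology group -/

section H2

instance continuousSMul_zmod (q : ℕ) : ContinuousSMul (ZMod q) (ULift.{u} (ZMod q)) :=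
  ⟨continuous_of_discreteTopology⟩

/-- The trivial `G`-module `ℤ/q` (discrete, and moved to the universe of `G`). -/
abbrev trivialRep (q : ℕ) (G : Type u) [Group G] : TopRep.{u, 0, u} (ZMod q) G :=
  TopRep.of (ContRepresentation.trivial (ZMod q) G (ULift.{u} (ZMod q)))

/-- `H²(G) = H²(G, ℤ/q)`, the continuous cohomology for the trivial action of `G` on `ℤ/q`. -/
noncomputable abbrev H2 (q : ℕ) (G : Type u) [Group G] [TopologicalSpace G]
    [IsTopologicalGroup G] : TopModuleCat.{u, 0} (ZMod q) :=
  continuousCohomology.{0, u, u} 2 (trivialRep q G)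

/-- The map `H²(G) → H²(H)` induced by a continuous homomorphism `f : H → G` and the identity of
`ℤ/q`; it is the inflation when `f` is surjective. -/
noncomputable def inf2 (q : ℕ) {G H : Type u} [Group G] [TopologicalSpace G]
    [IsTopologicalGroup G] [Group H] [TopologicalSpace H] [IsTopologicalGroup H]
    (f : H →ₜ* G) : H2 q G ⟶ H2 q H :=
  ContinuousCohomology.map.{0, u, u} (X := trivialRep q G) (Y := trivialRep q H) f
    (TopRep.ofHom ⟨ContinuousLinearMap.id (ZMod q) (ULift.{u} (ZMod q)), fun _ => rfl⟩) 2

end H2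

end QCentral

/-! Write Γ = G(p) and Q = G^[2]. The equivalence of (a) and (b) is transgression, done on cochains.
Since S is free pro-p, the pullback to S of a 2-cocycle c of Γ is the coboundary of some continuous
b, and b shifts along R by an S-invariant character ψ: b(sr) = b(s) + ψ(r)
(`exists_h1Inv_of_cocycle`). Conversely, every invariant character of R is the shift of some b whose
coboundary descends to Γ (`exists_cocycle_of_h1Inv`). The same holds for T and Q, compatibly with
restriction and inflation. The choice of b matters only up to homomorphisms on S, and these restrict
to R through T, so one map is onto exactly when the other is
(`inf2_surjective_iff_resH1_surjective`).

The equivalence of (b) and (c) is Pontryagin duality: invariant characters of N are the characters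
of N/N^q[N,S], an abelian profinite group of exponent dividing q, and restriction is dual to the map
in (c). Open normal subgroups reduce this to finite abelian groups (`resH1_surjective_iff`).
Finally, (c) and (d) both say that R ∩ T^q[T,S] lies in R^q[R,S]. -/

namespace TopModuleCat

/-! ### Homology of complexes of topological modules, in terms of elements -/

variable {R : Type u} [Ring R] [TopologicalSpace R]
  {ι : Type*} {c : ComplexShape ι} (K : HomologicalComplex (TopModuleCat.{v} R) c)

/-- `TopModuleCat` is not abelian; elementwise facts are read off the explicit kernel and cokernel,
to which cycles and homology are isomorphic by uniqueness of limits and colimits. -/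
theorem homologyπ_surjective (n : ι) : Function.Surjective (K.homologyπ n).hom := by
  let e := (K.homologyIsCokernel _ n rfl).coconePointUniqueUpToIso
    (isColimitCoker (K.toCycles (c.prev n) n))
  have h : K.homologyπ n ≫ e.hom = cokerπ _ :=
    (K.homologyIsCokernel _ n rfl).comp_coconePointUniqueUpToIso_hom _
      Limits.WalkingParallelPair.one
  have h' : K.homologyπ n = cokerπ _ ≫ e.inv := (Iso.eq_comp_inv e).2 h
  rw [h']
  refine Function.Surjective.comp (g := e.inv.hom) ?_ (cokerπ_surjective _)
  exact fun x => ⟨e.hom.hom x, ConcreteCategory.congr_hom e.hom_inv_id x⟩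

theorem homologyπ_eq_zero_iff {i j : ι} (hij : c.prev j = i) (z : K.cycles j) :
    (K.homologyπ j).hom z = 0 ↔ ∃ y : K.X i, (K.toCycles i j).hom y = z := by
  let e := (K.homologyIsCokernel i j hij).coconePointUniqueUpToIso
    (isColimitCoker (K.toCycles i j))
  have h : K.homologyπ j ≫ e.hom = cokerπ _ :=
    (K.homologyIsCokernel i j hij).comp_coconePointUniqueUpToIso_hom _
      Limits.WalkingParallelPair.one
  have h' : K.homologyπ j = cokerπ _ ≫ e.inv := (Iso.eq_comp_inv e).2 h
  trans (cokerπ (K.toCycles i j)).hom z = 0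
  · constructor
    · intro hz
      rw [← h, hom_comp, ContinuousLinearMap.comp_apply, hz, map_zero]
    · intro hz
      rw [h', hom_comp, ContinuousLinearMap.comp_apply, hz, map_zero]
  · exact Submodule.Quotient.mk_eq_zero _

theorem iCycles_injective (n : ι) : Function.Injective (K.iCycles n).hom := by
  let e := (K.cyclesIsKernel n _ rfl).conePointUniqueUpToIso (isLimitKer (K.d n (c.next n)))
  have h : e.hom ≫ kerι _ = K.iCycles n :=
    (K.cyclesIsKernel n _ rfl).conePointUniqueUpToIso_hom_comp _ Limits.WalkingParallelPair.zero
  rw [← h]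
  refine Function.Injective.comp (g := (kerι (K.d n (c.next n))).hom) (f := e.hom.hom)
    Subtype.val_injective ?_
  exact Function.LeftInverse.injective (g := e.inv.hom) fun x =>
    ConcreteCategory.congr_hom e.hom_inv_id x

theorem exists_iCycles_eq {i j : ι} (hij : c.next i = j) (x : K.X i) (hx : (K.d i j).hom x = 0) :
    ∃ z : K.cycles i, (K.iCycles i).hom z = x := by
  let e := (K.cyclesIsKernel i j hij).conePointUniqueUpToIso (isLimitKer (K.d i j))
  have h : e.inv ≫ K.iCycles i = kerι _ :=
    (K.cyclesIsKernel i j hij).conePointUniqueUpToIso_inv_comp _ Limits.WalkingParallelPair.zero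
  exact ⟨e.inv.hom ⟨x, hx⟩, ConcreteCategory.congr_hom h ⟨x, hx⟩⟩

theorem d_iCycles {i j : ι} (z : K.cycles i) : (K.d i j).hom ((K.iCycles i).hom z) = 0 :=
  ConcreteCategory.congr_hom (K.iCycles_d i j) z

/-- Brings a statement about homology down to cochains: every class has a cycle representative, and
equality of classes means differing by a boundary. -/
theorem homologyMap_surjective_iff {K L : HomologicalComplex (TopModuleCat.{v} R) c} (f : K ⟶ L)
    {i j k : ι} (hij : c.prev j = i) (hjk : c.next j = k) :
    Function.Surjective (HomologicalComplex.homologyMap f j) ↔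
      ∀ y : L.X j, (L.d j k).hom y = 0 → ∃ x : K.X j, (K.d j k).hom x = 0 ∧
        ∃ w : L.X i, y = (f.f j).hom x + (L.d i j).hom w := by
  have hπ (z : K.cycles j) : (HomologicalComplex.homologyMap f j).hom ((K.homologyπ j).hom z) =
      (L.homologyπ j).hom ((HomologicalComplex.cyclesMap f j).hom z) :=
    ConcreteCategory.congr_hom (HomologicalComplex.homologyπ_naturality f j) z
  have hi (z : K.cycles j) : (L.iCycles j).hom ((HomologicalComplex.cyclesMap f j).hom z) =
      (f.f j).hom ((K.iCycles j).hom z) :=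
    ConcreteCategory.congr_hom (HomologicalComplex.cyclesMap_i f j) z
  have ht (w : L.X i) : (L.iCycles j).hom ((L.toCycles i j).hom w) = (L.d i j).hom w :=
    ConcreteCategory.congr_hom (L.toCycles_i i j) w
  constructor
  · intro h y hy
    obtain ⟨y, rfl⟩ := exists_iCycles_eq L hjk y hy
    obtain ⟨x, hx⟩ := h ((L.homologyπ j).hom y)
    obtain ⟨x, rfl⟩ := homologyπ_surjective K j x
    refine ⟨(K.iCycles j).hom x, d_iCycles K x, ?_⟩
    have h0 : (L.homologyπ j).hom (y - (HomologicalComplex.cyclesMap f j).hom x) = 0 := by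
      rw [map_sub, sub_eq_zero, ← hπ]
      exact hx.symm
    obtain ⟨w, hw⟩ := (homologyπ_eq_zero_iff L hij _).1 h0
    refine ⟨w, ?_⟩
    rw [← ht, hw, ← hi, map_sub, add_sub_cancel]
  · intro h y
    obtain ⟨y, rfl⟩ := homologyπ_surjective L j y
    obtain ⟨x, hx, w, hw⟩ := h _ (d_iCycles L (j := k) y)
    obtain ⟨x, rfl⟩ := exists_iCycles_eq K hjk x hx
    refine ⟨(K.homologyπ j).hom x, ?_⟩
    refine (hπ x).trans (Eq.symm ?_)
    rw [← sub_eq_zero, ← map_sub, homologyπ_eq_zero_iff L hij]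
    refine ⟨w, iCycles_injective L j ?_⟩
    rw [ht, map_sub, hi, hw, add_sub_cancel_left]

end TopModuleCat

namespace QCentral

open TopRep

/-! ### Degree-two cohomology by inhomogeneous cocycles -/

section Cocycles

/-- Continuous inhomogeneous `2`-cocycles with values in the trivial module `ℤ/q`. -/
structure IsCocycle {q : ℕ} {G : Type u} [Group G] [TopologicalSpace G] (c : G → G → ZMod q) :
    Prop where
  continuous : Continuous fun x : G × G => c x.1 x.2
  cocycle (x y z : G) : c x y + c (x * y) z = c y z + c x (y * z)

variable {q : ℕ} {G H : Type u} [Group G] [TopologicalSpace G] [IsTopologicalGroup G] [Group H]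
  [TopologicalSpace H] [IsTopologicalGroup H]

theorem homogeneousCochains_d_one_apply (σ : (homogeneousCochains (trivialRep q G)).X 1)
    (x y z : G) :
    (((homogeneousCochains (trivialRep q G)).d 1 2).hom σ).1 x y z =
      σ.1 y z - (σ.1 x z - σ.1 x y) := by
  rw [homogeneousCochains.d_apply]
  rfl

theorem homogeneousCochains_d_two_apply (σ : (homogeneousCochains (trivialRep q G)).X 2)
    (x y z w : G) :
    (((homogeneousCochains (trivialRep q G)).d 2 3).hom σ).1 x y z w =
      σ.1 y z w - (σ.1 x z w - (σ.1 x y w - σ.1 x y z)) := by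
  rw [homogeneousCochains.d_apply]
  rfl

theorem homogeneousCochains_one_mul_left (σ : (homogeneousCochains (trivialRep q G)).X 1)
    (g x y : G) : σ.1 (g * x) (g * y) = σ.1 x y := by
  -- An element acts on cochains by translating the arguments by its inverse, so invariance is
  -- applied to `g⁻¹`.
  have h := congrArg (fun f : C(G, C(G, ULift.{u} (ZMod q))) => f x y) (σ.2 g⁻¹)
  refine Eq.trans ?_ h
  change _ = σ.1 (g⁻¹⁻¹ * x) (g⁻¹⁻¹ * y)
  rw [inv_inv]

theorem homogeneousCochains_two_mul_left (σ : (homogeneousCochains (trivialRep q G)).X 2)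
    (g x y z : G) : σ.1 (g * x) (g * y) (g * z) = σ.1 x y z := by
  have h := congrArg (fun f : C(G, C(G, C(G, ULift.{u} (ZMod q)))) => f x y z) (σ.2 g⁻¹)
  refine Eq.trans ?_ h
  change _ = σ.1 (g⁻¹⁻¹ * x) (g⁻¹⁻¹ * y) (g⁻¹⁻¹ * z)
  rw [inv_inv]

/-- The homogeneous cochain `(x, y) ↦ a (x⁻¹ y)`. -/
def homogeneousOne (a : G → ZMod q) (ha : Continuous a) :
    (homogeneousCochains (trivialRep q G)).X 1 :=
  ⟨ContinuousMap.curry (⟨fun x : G × G => ULift.up (a (x.1⁻¹ * x.2)), by fun_prop⟩ :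
      C(G × G, ULift.{u} (ZMod q))), fun g => by
    refine ContinuousMap.ext fun x => ContinuousMap.ext fun y => ?_
    change ULift.up (a ((g⁻¹ * x)⁻¹ * (g⁻¹ * y))) = ULift.up (a (x⁻¹ * y))
    congr 2
    group⟩

/-- The homogeneous cochain `(x, y, z) ↦ c (x⁻¹ y, y⁻¹ z)`. -/
def homogeneousTwo (c : G → G → ZMod q) (hc : Continuous fun x : G × G => c x.1 x.2) :
    (homogeneousCochains (trivialRep q G)).X 2 :=
  ⟨ContinuousMap.curry (ContinuousMap.curry
      (⟨fun x : (G × G) × G => ULift.up (c (x.1.1⁻¹ * x.1.2) (x.1.2⁻¹ * x.2)),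
        continuous_uliftUp.comp (hc.comp (f := fun x : (G × G) × G =>
          (x.1.1⁻¹ * x.1.2, x.1.2⁻¹ * x.2)) (by fun_prop))⟩ :
      C((G × G) × G, ULift.{u} (ZMod q)))), fun g => by
    refine ContinuousMap.ext fun x => ContinuousMap.ext fun y => ContinuousMap.ext fun z => ?_
    change ULift.up (c ((g⁻¹ * x)⁻¹ * (g⁻¹ * y)) ((g⁻¹ * y)⁻¹ * (g⁻¹ * z))) =
      ULift.up (c (x⁻¹ * y) (y⁻¹ * z))
    congr 2 <;> group⟩

theorem homogeneousTwo_d_eq_zero {c : G → G → ZMod q} (hc : IsCocycle c) :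
    ((homogeneousCochains (trivialRep q G)).d 2 3).hom (homogeneousTwo c hc.continuous) = 0 := by
  refine Subtype.ext (ContinuousMap.ext fun x => ContinuousMap.ext fun y =>
    ContinuousMap.ext fun z => ContinuousMap.ext fun w => ?_)
  rw [homogeneousCochains_d_two_apply]
  refine ULift.ext _ _ ?_
  change c (y⁻¹ * z) (z⁻¹ * w) - (c (x⁻¹ * z) (z⁻¹ * w) -
    (c (x⁻¹ * y) (y⁻¹ * w) - c (x⁻¹ * y) (y⁻¹ * z))) = 0
  have h := hc.cocycle (x⁻¹ * y) (y⁻¹ * z) (z⁻¹ * w)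
  rw [show x⁻¹ * y * (y⁻¹ * z) = x⁻¹ * z by group,
    show y⁻¹ * z * (z⁻¹ * w) = y⁻¹ * w by group] at h
  linear_combination -h

/-- The cocycle identity is the homogeneous one at (1, x, xy, xyz), after translating the first term
by x⁻¹. Compactness makes the curried cochain jointly continuous. -/
theorem isCocycle_of_d_eq_zero [CompactSpace G] (σ : (homogeneousCochains (trivialRep q G)).X 2)
    (hσ : ((homogeneousCochains (trivialRep q G)).d 2 3).hom σ = 0) :
    IsCocycle fun x y : G => (σ.1 1 x (x * y)).down where
  continuous := by
    have h : Continuous fun x : G × G => (σ.1 1 : C(G, C(G, ULift.{u} (ZMod q)))) x.1 x.2 :=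
      ContinuousMap.continuous_uncurry_of_continuous (σ.1 1)
    exact continuous_uliftDown.comp (h.comp (f := fun x : G × G => (x.1, x.1 * x.2))
      (by fun_prop))
  cocycle x y z := by
    have h := homogeneousCochains_d_two_apply σ 1 x (x * y) (x * y * z)
    rw [hσ] at h
    have h' : (0 : ZMod q) = (σ.1 x (x * y) (x * y * z)).down - ((σ.1 1 (x * y) (x * y * z)).down -
        ((σ.1 1 x (x * y * z)).down - (σ.1 1 x (x * y)).down)) := congrArg ULift.down h
    have h'' := homogeneousCochains_two_mul_left σ x 1 y (y * z)
    rw [mul_one, ← mul_assoc] at h''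
    rw [h''] at h'
    simp only [← mul_assoc]
    linear_combination h'

theorem inf2_surjective_iff [CompactSpace G] [CompactSpace H] (φ : H →ₜ* G) :
    Function.Surjective (inf2 q φ) ↔ ∀ c : H → H → ZMod q, IsCocycle c →
      ∃ e : G → G → ZMod q, IsCocycle e ∧ ∃ a : H → ZMod q, Continuous a ∧
        ∀ x y, c x y = e (φ x) (φ y) + (a x + a y - a (x * y)) := by
  refine (TopModuleCat.homologyMap_surjective_iff (i := 1) (j := 2) (k := 3)
    (ContinuousCohomology.cochainsMap (X := trivialRep q G) (Y := trivialRep q H) φ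
      (TopRep.ofHom ⟨ContinuousLinearMap.id (ZMod q) (ULift.{u} (ZMod q)), fun _ => rfl⟩))
    (by simp) (by simp)).trans ?_
  constructor
  · intro h c hc
    obtain ⟨σ, hσ, w, hw⟩ := h (homogeneousTwo c hc.continuous) (homogeneousTwo_d_eq_zero hc)
    refine ⟨_, isCocycle_of_d_eq_zero σ hσ, fun x => (w.1 1 x).down,
      continuous_uliftDown.comp (w.1 1 : C(H, ULift.{u} (ZMod q))).continuous, fun x y => ?_⟩
    have h1 := congrArg (fun τ : (homogeneousCochains (trivialRep q H)).X 2 =>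
      (τ.1 1 x (x * y)).down) hw
    have h2 := congrArg ULift.down (homogeneousCochains_d_one_apply w 1 x (x * y))
    have h3 := homogeneousCochains_one_mul_left w x 1 y
    have h4 : c (1⁻¹ * x) (x⁻¹ * (x * y)) = (σ.1 (φ 1) (φ x) (φ (x * y))).down +
        ((((homogeneousCochains (trivialRep q H)).d 1 2).hom w).1 1 x (x * y)).down := h1
    rw [h2] at h4
    change _ = _ + ((w.1 x (x * y)).down - ((w.1 1 (x * y)).down - (w.1 1 x).down)) at h4
    rw [mul_one] at h3
    rw [h3, inv_one, one_mul, inv_mul_cancel_left, map_one, map_mul] at h4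
    linear_combination h4
  · intro h τ hτ
    obtain ⟨e, he, a, ha, hc⟩ := h _ (isCocycle_of_d_eq_zero τ hτ)
    refine ⟨homogeneousTwo e he.continuous, homogeneousTwo_d_eq_zero he, homogeneousOne a ha, ?_⟩
    refine Subtype.ext (ContinuousMap.ext fun x => ContinuousMap.ext fun y =>
      ContinuousMap.ext fun z => ULift.ext _ _ ?_)
    have h2 := congrArg ULift.down (homogeneousCochains_d_one_apply (homogeneousOne a ha) x y z)
    change _ = e ((φ x)⁻¹ * φ y) ((φ y)⁻¹ * φ z) +
      ((((homogeneousCochains (trivialRep q H)).d 1 2).hom (homogeneousOne a ha)).1 x y z).down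
    rw [h2]
    change _ = _ + (a (y⁻¹ * z) - (a (x⁻¹ * z) - a (x⁻¹ * y)))
    have h3 := hc (x⁻¹ * y) (y⁻¹ * z)
    have h4 := homogeneousCochains_two_mul_left τ x⁻¹ x y z
    rw [show x⁻¹ * y * (y⁻¹ * z) = x⁻¹ * z by group, ← inv_mul_cancel x, h4] at h3
    simp only [map_mul, map_inv] at h3
    linear_combination h3

end Cocycles

/-! ### Central extensions by ℤ/q, and their splitting over a free pro-p group -/

section Splitting

namespace IsCocycle

variable {q : ℕ} {G : Type u} [Group G] [TopologicalSpace G] {c : G → G → ZMod q}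

theorem one_left (hc : IsCocycle c) (x : G) : c 1 x = c 1 1 := by
  have h := hc.cocycle 1 1 x
  simp only [one_mul] at h
  linear_combination -h

theorem one_right (hc : IsCocycle c) (x : G) : c x 1 = c 1 1 := by
  have h := hc.cocycle x 1 1
  simp only [mul_one] at h
  linear_combination h

theorem comp {H : Type v} [Group H] [TopologicalSpace H] (hc : IsCocycle c) (f : H →ₜ* G) :
    IsCocycle fun x y => c (f x) (f y) where
  continuous := hc.continuous.comp (f := fun x : H × H => (f x.1, f x.2)) (by fun_prop)
  cocycle x y z := by
    simp only [map_mul]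
    exact hc.cocycle _ _ _

end IsCocycle

/-- The extension of `G` by `ℤ/q` defined by a continuous cocycle. -/
@[ext]
structure CocycleExtension {q : ℕ} {G : Type u} [Group G] [TopologicalSpace G]
    {c : G → G → ZMod q} (hc : IsCocycle c) where
  /-- The component in `ℤ/q`. -/
  fst : ZMod q
  /-- The component in `G`. -/
  snd : G

namespace CocycleExtension

variable {q : ℕ} {G : Type u} [Group G] [TopologicalSpace G] {c : G → G → ZMod q}
  (hc : IsCocycle c)

/-- The underlying set of the extension is the product `ℤ/q × G`. -/
def equivProd : CocycleExtension hc ≃ ZMod q × G where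
  toFun x := (x.fst, x.snd)
  invFun x := ⟨x.1, x.2⟩

instance : TopologicalSpace (CocycleExtension hc) :=
  .induced (equivProd hc) inferInstance

/-- The underlying space of the extension is the product `ℤ/q × G`. -/
def homeoProd : CocycleExtension hc ≃ₜ ZMod q × G :=
  (equivProd hc).toHomeomorphOfIsInducing ⟨rfl⟩

theorem continuous_fst : Continuous (fst : CocycleExtension hc → ZMod q) :=
  _root_.continuous_fst.comp (homeoProd hc).continuous

theorem continuous_snd : Continuous (snd : CocycleExtension hc → G) :=
  _root_.continuous_snd.comp (homeoProd hc).continuous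

theorem continuous_mk {X : Type*} [TopologicalSpace X] {f : X → ZMod q} {g : X → G}
    (hf : Continuous f) (hg : Continuous g) :
    Continuous fun x => (⟨f x, g x⟩ : CocycleExtension hc) :=
  (homeoProd hc).symm.continuous.comp (hf.prodMk hg)

instance : Mul (CocycleExtension hc) :=
  ⟨fun x y => ⟨x.fst + y.fst + c x.snd y.snd, x.snd * y.snd⟩⟩

/-- Cocycles are not normalised: c(1, x) and c(x, 1) equal the constant c(1, 1), which shifts the
neutral element. -/
instance : One (CocycleExtension hc) :=
  ⟨⟨-c 1 1, 1⟩⟩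

instance : Inv (CocycleExtension hc) :=
  ⟨fun x => ⟨-x.fst - c x.snd⁻¹ x.snd - c 1 1, x.snd⁻¹⟩⟩

variable {hc}

@[simp] theorem mul_fst (x y : CocycleExtension hc) :
    (x * y).fst = x.fst + y.fst + c x.snd y.snd := rfl

@[simp] theorem mul_snd (x y : CocycleExtension hc) : (x * y).snd = x.snd * y.snd := rfl

@[simp] theorem one_fst : (1 : CocycleExtension hc).fst = -c 1 1 := rfl

@[simp] theorem one_snd : (1 : CocycleExtension hc).snd = 1 := rfl

@[simp] theorem inv_fst (x : CocycleExtension hc) :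
    x⁻¹.fst = -x.fst - c x.snd⁻¹ x.snd - c 1 1 := rfl

@[simp] theorem inv_snd (x : CocycleExtension hc) : x⁻¹.snd = x.snd⁻¹ := rfl

instance : Group (CocycleExtension hc) :=
  Group.ofLeftAxioms
    (fun x y z => CocycleExtension.ext
      (by simp only [mul_fst, mul_snd]; linear_combination hc.cocycle x.snd y.snd z.snd)
      (mul_assoc _ _ _))
    (fun x => CocycleExtension.ext
      (by simp only [mul_fst, one_fst, one_snd, hc.one_left]; ring) (one_mul _))
    (fun x => CocycleExtension.ext
      (by simp only [mul_fst, inv_fst, inv_snd, one_fst]; ring) (inv_mul_cancel _))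

instance [IsTopologicalGroup G] : IsTopologicalGroup (CocycleExtension hc) where
  continuous_mul := by
    have h1 := continuous_fst hc
    have h2 := continuous_snd hc
    have h3 : Continuous fun x : CocycleExtension hc × CocycleExtension hc =>
        c x.1.snd x.2.snd :=
      hc.continuous.comp (f := fun x : CocycleExtension hc × CocycleExtension hc =>
        (x.1.snd, x.2.snd)) (by fun_prop)
    exact continuous_mk hc
      (((h1.comp _root_.continuous_fst).add (h1.comp _root_.continuous_snd)).add h3)
      ((h2.comp _root_.continuous_fst).mul (h2.comp _root_.continuous_snd))
  continuous_inv := by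
    have h1 := continuous_fst hc
    have h2 := continuous_snd hc
    have h3 : Continuous fun x : CocycleExtension hc => c x.snd⁻¹ x.snd :=
      hc.continuous.comp (f := fun x : CocycleExtension hc => (x.snd⁻¹, x.snd)) (by fun_prop)
    exact continuous_mk hc ((h1.neg.sub h3).sub continuous_const) h2.inv

instance [CompactSpace G] [NeZero q] : CompactSpace (CocycleExtension hc) :=
  (homeoProd hc).symm.compactSpace

instance [TotallyDisconnectedSpace G] : TotallyDisconnectedSpace (CocycleExtension hc) :=
  (homeoProd hc).symm.totallyDisconnectedSpace

variable (hc) in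
/-- The projection of the extension onto `G`. -/
def proj : CocycleExtension hc →ₜ* G where
  toFun := snd
  map_one' := rfl
  map_mul' _ _ := rfl
  continuous_toFun := continuous_snd hc

/-- The kernel of the projection is a copy of ℤ/q through the coordinate `x.fst + c 1 1`, hence is
killed by q. -/
theorem pow_of_snd_eq_one {x : CocycleExtension hc} (hx : x.snd = 1) : x ^ q = 1 := by
  have h (n : ℕ) : x ^ n = ⟨n * (x.fst + c 1 1) - c 1 1, 1⟩ := by
    induction n with
    | zero => exact CocycleExtension.ext (by simp) (by simp)
    | succ n ih =>
      rw [pow_succ, ih]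
      refine CocycleExtension.ext ?_ (by simp [hx])
      simp only [mul_fst, hx]
      push_cast
      ring
  rw [h]
  exact CocycleExtension.ext (by simp) rfl

/-- If V is the image of U in G, some g^(p^k) agrees with an element of U up to the kernel of the
projection. That kernel is killed by p^d, so g^(p^(k+d)) lies in U. -/
theorem isProP [IsTopologicalGroup G] {p d : ℕ} (hq : q = p ^ d) (hG : IsProP p G) :
    IsProP p (CocycleExtension hc) := by
  intro U g
  obtain ⟨g, rfl⟩ := QuotientGroup.mk_surjective g
  -- A continuous section with s(1) = 1, not a homomorphism; it shows that the image of U is open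
  -- and that the projection is onto.
  let s : G → CocycleExtension hc := fun x => ⟨-c 1 1, x⟩
  have hs : Continuous s := continuous_mk hc continuous_const continuous_id
  let V : OpenNormalSubgroup G :=
    { toSubgroup := U.toSubgroup.map (proj hc).toMonoidHom
      isOpen' := by
        refine Subgroup.isOpen_of_mem_nhds _ (g := 1) ?_
        have h1 : (U : Set (CocycleExtension hc)) ∈ nhds (s 1) := U.isOpen'.mem_nhds U.one_mem'
        exact Filter.mem_of_superset (hs.continuousAt h1) fun x hx => ⟨s x, hx, rfl⟩
      isNormal' := U.isNormal'.map _ fun x => ⟨s x, rfl⟩ }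
  have : V.toSubgroup.Normal := V.isNormal'
  obtain ⟨k, hk⟩ := hG V (g.snd : G ⧸ V.toSubgroup)
  rw [← QuotientGroup.mk_pow, QuotientGroup.eq_one_iff] at hk
  obtain ⟨u, hu, hug⟩ := hk
  refine ⟨k + d, ?_⟩
  have h2 : (g ^ p ^ k * u⁻¹).snd = 1 := by
    have h3 : proj hc u = proj hc g ^ p ^ k := hug
    change proj hc (g ^ p ^ k * u⁻¹) = 1
    rw [map_mul, map_pow, map_inv, h3, mul_inv_cancel]
  have hu' : ((u : CocycleExtension hc) : CocycleExtension hc ⧸ U.toSubgroup) = 1 :=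
    (QuotientGroup.eq_one_iff u).2 hu
  have h4 := congrArg (QuotientGroup.mk' U.toSubgroup) (pow_of_snd_eq_one h2)
  rw [map_pow, map_mul, map_inv, map_pow] at h4
  change ((g : CocycleExtension hc ⧸ U.toSubgroup) ^ p ^ k *
    (u : CocycleExtension hc ⧸ U.toSubgroup)⁻¹) ^ q = _ at h4
  rw [hu', inv_one, mul_one, map_one] at h4
  rw [pow_add, pow_mul, ← hq]
  exact h4

end CocycleExtension

/-- The basis lifts to the extension, which is pro-p, so freeness gives F : S → extension.
Uniqueness for maps S → S makes F a section of the projection, and its ℤ/q-component is b. Lifting x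
to `⟨-c 1 1, x⟩` preserves convergence to 1, because this section is continuous and sends 1 to 1. -/
theorem IsFreeProP.exists_splitting {p d : ℕ} [Fact p.Prime] {S : Type v} [Group S]
    [TopologicalSpace S] [IsTopologicalGroup S] [CompactSpace S] [TotallyDisconnectedSpace S]
    (hS : IsFreeProP p S) {c : S → S → ZMod (p ^ d)} (hc : IsCocycle c) :
    ∃ b : S → ZMod (p ^ d), Continuous b ∧ ∀ s t, b (s * t) = b s + b t + c s t := by
  obtain ⟨hp, X, hX, hF⟩ := hS
  obtain ⟨F, hFX, -⟩ := hF (CocycleExtension hc) (CocycleExtension.isProP rfl hp)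
    (fun x => ⟨-c 1 1, x⟩) fun W hW h1 =>
      hX {s | (⟨-c 1 1, s⟩ : CocycleExtension hc) ∈ W}
        (hW.preimage (CocycleExtension.continuous_mk hc continuous_const continuous_id)) h1
  have hid : (CocycleExtension.proj hc).comp F = ContinuousMonoidHom.id S :=
    (hF S hp (fun x => x) hX).unique
      (fun x => by
        rw [ContinuousMonoidHom.comp_toFun, hFX x]
        rfl)
      fun x => rfl
  have hsnd (s : S) : (F s).snd = s := DFunLike.congr_fun hid s
  refine ⟨fun s => (F s).fst, (CocycleExtension.continuous_fst hc).comp F.continuous,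
    fun s t => ?_⟩
  have h := congrArg CocycleExtension.fst (map_mul F s t)
  rwa [CocycleExtension.mul_fst, hsnd, hsnd] at h

end Splitting

/-! ### Separating closed normal subgroups from closed sets -/

section Separation

variable {S : Type v} [Group S] [TopologicalSpace S] [IsTopologicalGroup S] [CompactSpace S]
  [TotallyDisconnectedSpace S]

/-- By compactness A·W misses C for some neighbourhood W of 1; take V = AU with U open normal inside
W. -/
theorem exists_openNormalSubgroup_ge_disjoint {A : Subgroup S} [A.Normal]
    (hA : IsClosed (A : Set S)) {C : Set S} (hC : IsClosed C) (h : ∀ a ∈ A, a ∉ C) :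
    ∃ V : OpenNormalSubgroup S, A ≤ V.toSubgroup ∧ ∀ v ∈ V.toSubgroup, v ∉ C := by
  obtain ⟨W, hW, hAW⟩ := compact_open_separated_mul_right hA.isCompact hC.isOpen_compl h
  obtain ⟨U, hU⟩ := ProfiniteGrp.exist_openNormalSubgroup_sub_open_nhds_of_one
    (isOpen_interior (s := W)) (mem_interior_iff_mem_nhds.2 hW)
  refine ⟨{ toSubgroup := A ⊔ U.toSubgroup
            isOpen' := Subgroup.isOpen_mono le_sup_right U.isOpen'
            isNormal' := Subgroup.sup_normal _ _ }, le_sup_left, fun v hv => ?_⟩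
  obtain ⟨a, ha, u, hu, rfl⟩ := Subgroup.mem_sup_of_normal_right.1 hv
  exact hAW (Set.mul_mem_mul ha (interior_subset (hU hu)))

end Separation

/-! ### Duality for finite abelian groups of exponent dividing q -/

section Duality

/-- Identifies ℤ/q with the q-th roots of unity in ℂ. Complex characters of a group killed by q take
values there, so duality over ℂˣ transfers to ℤ/q. -/
theorem exists_zmod_embedding (q : ℕ) [NeZero q] :
    ∃ ι : Multiplicative (ZMod q) →* ℂˣ, Function.Injective ι ∧
      ∀ u : ℂˣ, u ^ q = 1 → u ∈ ι.range := by
  obtain ⟨ζ, hζ⟩ := HasEnoughRootsOfUnity.exists_primitiveRoot ℂ q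
  have hu := hζ.isUnit_unit (NeZero.ne q)
  set z := (hζ.isUnit (NeZero.ne q)).unit
  let e := hu.zmodEquivZPowers
  refine ⟨(Subgroup.zpowers z).subtype.comp (AddMonoidHom.toMultiplicativeLeft e.toAddMonoidHom),
    ?_, fun u h => ?_⟩
  · exact Subtype.val_injective.comp e.injective
  · have hmem : u ∈ Subgroup.zpowers z := by
      rw [hu.zpowers_eq]
      exact h
    obtain ⟨x, hx⟩ := e.surjective (Additive.ofMul ⟨u, hmem⟩)
    exact ⟨Multiplicative.ofAdd x, congrArg Subtype.val hx⟩

variable {q : ℕ} {A : Type*} [CommGroup A]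

theorem exists_lift_zmod {ι : Multiplicative (ZMod q) →* ℂˣ} (hι : Function.Injective ι)
    (hr : ∀ u : ℂˣ, u ^ q = 1 → u ∈ ι.range) (hA : ∀ a : A, a ^ q = 1) (χ : A →* ℂˣ) :
    ∃ ψ : A →* Multiplicative (ZMod q), ∀ a, ι (ψ a) = χ a := by
  let e := ι.ofInjective hι
  have h (a : A) : χ a ∈ ι.range := hr _ (by rw [← map_pow, hA, map_one])
  refine ⟨e.symm.toMonoidHom.comp (χ.codRestrict ι.range h), fun a => ?_⟩
  exact congrArg Subtype.val (e.apply_symm_apply ⟨χ a, h a⟩)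

variable [NeZero q] [Finite A]

theorem exists_zmod_character_extension (hA : ∀ a : A, a ^ q = 1) (H : Subgroup A)
    (ψ : H →* Multiplicative (ZMod q)) :
    ∃ χ : A →* Multiplicative (ZMod q), ∀ h : H, χ h = ψ h := by
  obtain ⟨ι, hι, hr⟩ := exists_zmod_embedding q
  have : NeZero (Monoid.exponent A) := ⟨Monoid.exponent_ne_zero_of_finite⟩
  obtain ⟨χ, hχ⟩ := MonoidHom.domRestrict_surjective (M := ℂ) H (ι.comp ψ)
  obtain ⟨χ', hχ'⟩ := exists_lift_zmod hι hr hA χ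
  exact ⟨χ', fun h => hι ((hχ' h).trans (DFunLike.congr_fun hχ h))⟩

theorem exists_zmod_character_ne_one (hA : ∀ a : A, a ^ q = 1) {a : A} (ha : a ≠ 1) :
    ∃ χ : A →* Multiplicative (ZMod q), χ a ≠ 1 := by
  obtain ⟨ι, hι, hr⟩ := exists_zmod_embedding q
  have : NeZero (Monoid.exponent A) := ⟨Monoid.exponent_ne_zero_of_finite⟩
  obtain ⟨χ, hχ⟩ := CommGroup.exists_apply_ne_one_of_hasEnoughRootsOfUnity A ℂ ha
  obtain ⟨χ', hχ'⟩ := exists_lift_zmod hι hr hA χ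
  refine ⟨χ', fun h => hχ ?_⟩
  rw [← hχ', h, map_one]

end Duality

/-! ### Invariant characters of N as the dual of N/N^q[N,S] -/

section InvariantCharacters

variable {S : Type v} [Group S] [TopologicalSpace S] [IsTopologicalGroup S] {q : ℕ}

theorem pow_mem_powComm {N : Subgroup S} {n : S} (hn : n ∈ N) : n ^ q ∈ powComm q N :=
  Subgroup.le_topologicalClosure _ (Subgroup.subset_closure (Or.inl ⟨n, hn, rfl⟩))

theorem commutator_mem_powComm {N : Subgroup S} {n : S} (hn : n ∈ N) (s : S) :
    n⁻¹ * s⁻¹ * n * s ∈ powComm q N :=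
  Subgroup.le_topologicalClosure _ (Subgroup.subset_closure (Or.inr ⟨n, hn, s, rfl⟩))

theorem powComm_le_of_isClosed {N K : Subgroup S} (hK : IsClosed (K : Set S))
    (h : powCommSet q N ⊆ K) : powComm q N ≤ K :=
  Subgroup.topologicalClosure_minimal _ ((Subgroup.closure_le K).2 h) hK

theorem powComm_le (N : Subgroup S) [hN : N.Normal] (hc : IsClosed (N : Set S)) :
    powComm q N ≤ N := by
  refine powComm_le_of_isClosed hc ?_
  rintro x (⟨n, hn, rfl⟩ | ⟨n, hn, s, rfl⟩)
  · exact pow_mem hn q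
  · have h := hN.conj_mem n hn s⁻¹
    rw [inv_inv] at h
    have h' := mul_mem (inv_mem hn) h
    rwa [← mul_assoc, ← mul_assoc] at h'

/-- The character kills q-th powers by the exponent of ℤ/q and commutators by invariance; its kernel
is closed in S because N is. -/
theorem apply_eq_one_of_mem_powComm {N : Subgroup S} [N.Normal] (hc : IsClosed (N : Set S))
    (ψ : H1Inv q N) {n : N} (hn : (n : S) ∈ powComm q N) : ψ.1 n = 1 := by
  have hcl : IsClosed ((ψ.1.toMonoidHom.ker.map N.subtype : Subgroup S) : Set S) := by
    rw [Subgroup.coe_map]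
    exact hc.isClosedEmbedding_subtypeVal.isClosedMap _
      (isClosed_singleton.preimage ψ.1.continuous)
  have hle : powComm q N ≤ ψ.1.toMonoidHom.ker.map N.subtype := by
    refine powComm_le_of_isClosed hcl ?_
    rintro x (⟨m, hm, rfl⟩ | ⟨m, hm, s, rfl⟩)
    · refine ⟨⟨m, hm⟩ ^ q, ?_, rfl⟩
      change ψ.1 (⟨m, hm⟩ ^ q) = 1
      rw [map_pow]
      exact Multiplicative.toAdd.injective (by simp)
    · have hms : s⁻¹ * m * s ∈ N := by
        simpa using (inferInstance : N.Normal).conj_mem m hm s⁻¹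
      refine ⟨⟨m, hm⟩⁻¹ * ⟨s⁻¹ * m * s, hms⟩, ?_, ?_⟩
      · change ψ.1 _ = 1
        rw [map_mul, map_inv, ψ.2 s ⟨m, hm⟩, inv_mul_cancel]
      · simp [mul_assoc]
  obtain ⟨m, hm, hmn⟩ := hle hn
  have : m = n := Subtype.ext hmn
  exact this ▸ hm

theorem powCommQuotientMap_injective_iff {R T : Subgroup S} [R.Normal] [T.Normal] (h : R ≤ T) :
    Function.Injective (powCommQuotientMap q h) ↔ R ⊓ powComm q T ≤ powComm q R := by
  rw [injective_iff_map_eq_one]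
  constructor
  · rintro hinj r ⟨hr, hrT⟩
    exact (QuotientGroup.eq_one_iff (⟨r, hr⟩ : R)).1
      (hinj _ ((QuotientGroup.eq_one_iff (⟨r, h hr⟩ : T)).2 hrT))
  · intro hle a ha
    obtain ⟨r, rfl⟩ := QuotientGroup.mk_surjective a
    exact (QuotientGroup.eq_one_iff r).2
      (hle ⟨r.2, (QuotientGroup.eq_one_iff (Subgroup.inclusion h r)).1 ha⟩)

/-- Continuity holds because the kernel contains the open subgroup T ∩ V, and invariance because V
contains [T, S]. -/
theorem exists_h1Inv_of_quotient {T : Subgroup S} [T.Normal] {V : OpenNormalSubgroup S}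
    (hV : powComm q T ≤ V.toSubgroup)
    (χ : T ⧸ V.toSubgroup.subgroupOf T →* Multiplicative (ZMod q)) :
    ∃ ψ : H1Inv q T, ∀ t : T, ψ.1 t = χ t := by
  have hcont : Continuous (χ.comp (QuotientGroup.mk' (V.toSubgroup.subgroupOf T))) := by
    refine continuous_of_continuousAt_one _ ?_
    refine Filter.EventuallyEq.continuousAt (y := 1) ?_
    have : IsOpen ((V.toSubgroup.subgroupOf T : Subgroup T) : Set T) :=
      V.isOpen'.preimage continuous_subtype_val
    filter_upwards [this.mem_nhds (one_mem _)] with t ht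
    rw [MonoidHom.comp_apply, QuotientGroup.mk'_apply, (QuotientGroup.eq_one_iff t).2 ht, map_one]
  refine ⟨⟨⟨χ.comp (QuotientGroup.mk' (V.toSubgroup.subgroupOf T)), hcont⟩, fun s n => ?_⟩,
    fun t => rfl⟩
  refine congrArg χ (Eq.symm (QuotientGroup.eq.2 (hV ?_)))
  have h := commutator_mem_powComm (q := q) n.2 s
  simpa [mul_assoc] using h

theorem quotient_pow_eq_one {T : Subgroup S} {V : OpenNormalSubgroup S}
    (hV : powComm q T ≤ V.toSubgroup) (a : T ⧸ V.toSubgroup.subgroupOf T) : a ^ q = 1 := by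
  obtain ⟨a, rfl⟩ := QuotientGroup.mk_surjective a
  rw [← QuotientGroup.mk_pow, QuotientGroup.eq_one_iff]
  exact hV (pow_mem_powComm a.2)

variable [CompactSpace S]

/-- The finite commutative group `T / (T ∩ V)`, for `V` open normal containing `T^q[T, S]`. -/
abbrev quotientCommGroup {T : Subgroup S} {V : OpenNormalSubgroup S}
    (hV : powComm q T ≤ V.toSubgroup) : CommGroup (T ⧸ V.toSubgroup.subgroupOf T) where
  mul_comm a b := by
    obtain ⟨a, rfl⟩ := QuotientGroup.mk_surjective a
    obtain ⟨b, rfl⟩ := QuotientGroup.mk_surjective b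
    rw [← QuotientGroup.mk_mul, ← QuotientGroup.mk_mul]
    refine Eq.symm (QuotientGroup.eq.2 (hV ?_))
    have h := commutator_mem_powComm (q := q) a.2 (b : S)
    simpa [mul_assoc] using h

theorem finite_quotient_subgroupOf (T : Subgroup S) (V : OpenNormalSubgroup S) :
    Finite (T ⧸ V.toSubgroup.subgroupOf T) := by
  have : Finite (S ⧸ V.toSubgroup) := V.toSubgroup.quotient_finite_of_isOpen V.isOpen'
  have : V.toSubgroup.FiniteIndex := Subgroup.finiteIndex_of_finite_quotient
  exact Subgroup.finite_quotient_of_finiteIndex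

variable [NeZero q]

theorem exists_h1Inv_apply_ne_one {T : Subgroup S} [T.Normal] {V : OpenNormalSubgroup S}
    (hV : powComm q T ≤ V.toSubgroup) {t : T} (ht : (t : S) ∉ V.toSubgroup) :
    ∃ ψ : H1Inv q T, ψ.1 t ≠ 1 := by
  let _ := quotientCommGroup hV
  have := finite_quotient_subgroupOf T V
  obtain ⟨χ, hχ⟩ := exists_zmod_character_ne_one (quotient_pow_eq_one hV)
    (a := (t : T ⧸ V.toSubgroup.subgroupOf T)) fun h => ht ((QuotientGroup.eq_one_iff t).1 h)
  obtain ⟨ψ, hψ⟩ := exists_h1Inv_of_quotient hV χ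
  exact ⟨ψ, by rwa [hψ]⟩

/-- The character descends to the image of R in the finite group T/(T ∩ V) and extends from there by
finite duality. -/
theorem exists_h1Inv_extension {R T : Subgroup S} [T.Normal] (hRT : R ≤ T)
    {V : OpenNormalSubgroup S} (hV : powComm q T ≤ V.toSubgroup)
    (ψ : R →* Multiplicative (ZMod q)) (hψ : ∀ r : R, (r : S) ∈ V.toSubgroup → ψ r = 1) :
    ∃ χ : H1Inv q T, ∀ r : R, χ.1 (Subgroup.inclusion hRT r) = ψ r := by
  let _ := quotientCommGroup hV
  have := finite_quotient_subgroupOf T V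
  let f : R →* T ⧸ V.toSubgroup.subgroupOf T :=
    (QuotientGroup.mk' _).comp (Subgroup.inclusion hRT)
  have hker : f.rangeRestrict.ker ≤ ψ.ker := by
    intro r hr
    rw [MonoidHom.ker_rangeRestrict] at hr
    exact hψ r ((QuotientGroup.eq_one_iff (Subgroup.inclusion hRT r)).1 hr)
  obtain ⟨χ, hχ⟩ := exists_zmod_character_extension (quotient_pow_eq_one hV) f.range
    (f.rangeRestrict.liftOfSurjective f.rangeRestrict_surjective ⟨ψ, hker⟩)
  obtain ⟨χ', hχ'⟩ := exists_h1Inv_of_quotient hV χ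
  refine ⟨χ', fun r => ?_⟩
  rw [hχ']
  exact (hχ (f.rangeRestrict r)).trans
    (f.rangeRestrict.liftOfRightInverse_comp_apply _ _ ⟨ψ, hker⟩ r)

variable [TotallyDisconnectedSpace S]

theorem resH1_surjective_iff {R T : Subgroup S} [R.Normal] [T.Normal]
    (hR : IsClosed (R : Set S)) (hT : IsClosed (T : Set S)) (h : R ≤ T) :
    Function.Surjective (resH1 q h) ↔ R ⊓ powComm q T ≤ powComm q R := by
  constructor
  · rintro hsurj r ⟨hr, hrT⟩
    -- Such an r is detected by an invariant character of R; that character cannot extend to T,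
    -- since extensions vanish on T^q[T,S].
    by_contra hrR
    obtain ⟨V, hV, hrV⟩ := exists_openNormalSubgroup_ge_disjoint (A := powComm q R)
      (Subgroup.isClosed_topologicalClosure _) (isClosed_singleton (x := r))
      fun a ha har => hrR (Set.mem_singleton_iff.1 har ▸ ha)
    obtain ⟨ψ, hψ⟩ := exists_h1Inv_apply_ne_one hV (t := ⟨r, hr⟩) fun hm => hrV r hm rfl
    obtain ⟨χ, rfl⟩ := hsurj ψ
    exact hψ (apply_eq_one_of_mem_powComm hT χ (n := ⟨r, h hr⟩) hrT)
  · intro hle ψ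
    -- The set where ψ ≠ 1 is closed and, by `hle`, misses T^q[T,S]. An open normal V ⊇ T^q[T,S]
    -- also missing it makes ψ trivial on R ∩ V.
    have hC : IsClosed (Subtype.val '' {r : R | ψ.1 r ≠ 1}) :=
      hR.isClosedEmbedding_subtypeVal.isClosedMap _
        ((isClosed_discrete {(1 : Multiplicative (ZMod q))}ᶜ).preimage ψ.1.continuous)
    obtain ⟨V, hV, hVC⟩ := exists_openNormalSubgroup_ge_disjoint (A := powComm q T)
      (Subgroup.isClosed_topologicalClosure _) hC (by
        rintro _ ha ⟨r, hr, rfl⟩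
        exact hr (apply_eq_one_of_mem_powComm hR ψ (hle ⟨r.2, ha⟩)))
    obtain ⟨χ, hχ⟩ := exists_h1Inv_extension h hV ψ.1.toMonoidHom fun r hr => by
      by_contra hne
      exact hVC r hr ⟨r, hne, rfl⟩
    exact ⟨χ, Subtype.ext (ContinuousMonoidHom.ext hχ)⟩

end InvariantCharacters

/-! ### Transgression at the level of cochains -/

section Transgression

variable {S : Type v} [Group S] [TopologicalSpace S] {q : ℕ} {Q : Type u} [Group Q]
  [TopologicalSpace Q]

theorem h1Inv_apply_conj {N : Subgroup S} [N.Normal] (ψ : H1Inv q N) (s : S) (n : N)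
    (h : s⁻¹ * n * s ∈ N) : ψ.1 ⟨s⁻¹ * n * s, h⟩ = ψ.1 n :=
  ψ.2 s n

/-- If one argument of the pulled-back cocycle is in the kernel, its value is e(1, 1) = -b(1). So
multiplying by n on either side shifts b by b(n) - b(1); comparing the two sides on s(s⁻¹ns) = ns
gives invariance. -/
theorem exists_h1Inv_of_cocycle {f : S →ₜ* Q} {e : Q → Q → ZMod q} (he : IsCocycle e)
    {b : S → ZMod q} (hb : Continuous b)
    (hbe : ∀ s t, b (s * t) = b s + b t + e (f s) (f t)) :
    ∃ ψ : H1Inv q f.toMonoidHom.ker, ∀ (s : S) (n : f.toMonoidHom.ker),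
      b (s * n) = b s + (ψ.1 n).toAdd := by
  have hn (n : f.toMonoidHom.ker) : f n = 1 := n.2
  have h1 : b 1 = -e 1 1 := by
    have h := hbe 1 1
    rw [mul_one, map_one] at h
    linear_combination -h
  have hr (s : S) (n : f.toMonoidHom.ker) : b (s * n) = b s + (b n - b 1) := by
    rw [hbe, hn, he.one_right, h1]
    ring
  have hl (s : S) (n : f.toMonoidHom.ker) : b (n * s) = b s + (b n - b 1) := by
    rw [hbe, hn, he.one_left, h1]
    ring
  let χ : f.toMonoidHom.ker →ₜ* Multiplicative (ZMod q) :=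
    { toFun n := Multiplicative.ofAdd (b n - b 1)
      map_one' := by simp
      map_mul' n m := by
        rw [← ofAdd_add]
        refine congrArg _ ?_
        rw [Subgroup.coe_mul, hr]
        ring
      continuous_toFun := continuous_ofAdd.comp
        ((hb.comp continuous_subtype_val).sub continuous_const) }
  refine ⟨⟨χ, fun s n => ?_⟩, hr⟩
  refine congrArg Multiplicative.ofAdd ?_
  have hm : s⁻¹ * n * s ∈ f.toMonoidHom.ker := by
    simpa using (inferInstance : f.toMonoidHom.ker.Normal).conj_mem n n.2 s⁻¹
  have h2 := hr s ⟨_, hm⟩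
  rw [show s * (s⁻¹ * n * s) = n * s by group, hl] at h2
  exact (add_left_cancel h2).symm

variable [IsTopologicalGroup S]

/-- Choose V open normal with ψ trivial on N ∩ V, and representatives t of the cosets of NV. Writing
s = t(s)·m·v with m ∈ N and v ∈ V, set b(s) = ψ(m); this is well defined because m is unique modulo
N ∩ V. -/
theorem exists_continuous_extension [CompactSpace S] [TotallyDisconnectedSpace S]
    {N : Subgroup S} [N.Normal] (hN : IsClosed (N : Set S)) (ψ : H1Inv q N) :
    ∃ b : S → ZMod q, Continuous b ∧
      ∀ (s : S) (n : N), b (s * n) = b s + (ψ.1 n).toAdd := by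
  have hker : IsClosed ((ψ.1.toMonoidHom.ker.map N.subtype : Subgroup S) : Set S) := by
    rw [Subgroup.coe_map]
    exact hN.isClosedEmbedding_subtypeVal.isClosedMap _
      (isClosed_singleton.preimage ψ.1.continuous)
  have hnorm : (ψ.1.toMonoidHom.ker.map N.subtype).Normal := by
    refine ⟨?_⟩
    rintro _ ⟨n, hn, rfl⟩ s
    have hs : s⁻¹⁻¹ * n * s⁻¹ ∈ N := by
      simpa using (inferInstance : N.Normal).conj_mem n n.2 s
    refine ⟨⟨s⁻¹⁻¹ * n * s⁻¹, hs⟩, ?_, by simp⟩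
    exact (h1Inv_apply_conj ψ s⁻¹ n hs).trans hn
  have hC : IsClosed (Subtype.val '' {r : N | ψ.1 r ≠ 1}) :=
    hN.isClosedEmbedding_subtypeVal.isClosedMap _
      ((isClosed_discrete {(1 : Multiplicative (ZMod q))}ᶜ).preimage ψ.1.continuous)
  obtain ⟨V, -, hVC⟩ := exists_openNormalSubgroup_ge_disjoint hker hC (by
    rintro _ ⟨n, hn, rfl⟩ ⟨m, hm, hmn⟩
    exact hm ((Subtype.ext hmn : m = n) ▸ hn))
  have hV (n : N) (hn : (n : S) ∈ V.toSubgroup) : ψ.1 n = 1 := by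
    by_contra hne
    exact hVC n hn ⟨n, hne, rfl⟩
  have hVn : V.toSubgroup.Normal := V.isNormal'
  let W : Subgroup S := N ⊔ V.toSubgroup
  let t (s : S) : S := (s : S ⧸ W).out
  have ht (s w : S) (hw : w ∈ W) : t (s * w) = t s := by
    have : ((s * w : S) : S ⧸ W) = s := QuotientGroup.eq.2 (by simpa using hw)
    simp only [t, this]
  have hex (s : S) : ∃ n : N, (n : S)⁻¹ * ((t s)⁻¹ * s) ∈ V.toSubgroup := by
    have hmem : (t s)⁻¹ * s ∈ W := QuotientGroup.eq.1 (QuotientGroup.out_eq' (s : S ⧸ W))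
    obtain ⟨n, hn, v, hv, h⟩ := Subgroup.mem_sup_of_normal_right.1 hmem
    exact ⟨⟨n, hn⟩, by simpa [← h] using hv⟩
  choose m hm using hex
  have huniq (s : S) (n : N) (h : (n : S)⁻¹ * ((t s)⁻¹ * s) ∈ V.toSubgroup) :
      ψ.1 (m s) = ψ.1 n := by
    have h1 := mul_mem h (inv_mem (hm s))
    have h2 := hV (n⁻¹ * m s) (by simpa [mul_assoc] using h1)
    rw [map_mul, map_inv, inv_mul_eq_one] at h2
    exact h2.symm
  refine ⟨fun s => (ψ.1 (m s)).toAdd, ?_, fun s n => ?_⟩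
  · refine continuous_iff_continuousAt.2 fun s => ?_
    refine Filter.EventuallyEq.continuousAt (y := (ψ.1 (m s)).toAdd) ?_
    have ho : IsOpen {x : S | s⁻¹ * x ∈ V.toSubgroup} :=
      V.isOpen'.preimage (continuous_const_mul s⁻¹)
    -- On the neighbourhood sV the representative t and the factor m can be kept, so b is locally
    -- constant.
    filter_upwards [ho.mem_nhds (by simp)] with x hx
    have hx' : x = s * (s⁻¹ * x) := by group
    refine congrArg _ (huniq x (m s) ?_)
    rw [hx', ht s _ (Subgroup.mem_sup_right hx)]
    have h1 := mul_mem (hm s) hx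
    simpa [mul_assoc] using h1
  · have h := huniq (s * n) (m s * n) (by
      rw [ht s _ (Subgroup.mem_sup_left n.2)]
      have h1 := hVn.conj_mem _ (hm s) (n : S)⁻¹
      simpa [mul_assoc] using h1)
    change (ψ.1 (m (s * n))).toAdd = _
    rw [h, map_mul, toAdd_mul]

/-- The coboundary D of the extension b is unchanged when either argument moves by the kernel
(invariance of ψ handles the left one), so it descends to Q. Continuity descends because S × S → Q ×
Q is a closed surjection, by compactness. -/
theorem exists_cocycle_of_h1Inv [CompactSpace S] [TotallyDisconnectedSpace S] [T2Space Q]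
    {f : S →ₜ* Q} (hf : Function.Surjective f) (ψ : H1Inv q f.toMonoidHom.ker) :
    ∃ (b : S → ZMod q) (e : Q → Q → ZMod q), Continuous b ∧ IsCocycle e ∧
      (∀ s t, b (s * t) = b s + b t + e (f s) (f t)) ∧
      ∀ (s : S) (n : f.toMonoidHom.ker), b (s * n) = b s + (ψ.1 n).toAdd := by
  have hker : IsClosed (f.toMonoidHom.ker : Set S) := isClosed_singleton.preimage f.continuous
  obtain ⟨b, hb, hbψ⟩ := exists_continuous_extension hker ψ
  let D (s t : S) : ZMod q := b (s * t) - b s - b t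
  have hDr (s t : S) (n : f.toMonoidHom.ker) : D s (t * n) = D s t := by
    simp only [D, ← mul_assoc, hbψ]
    ring
  have hDl (s t : S) (n : f.toMonoidHom.ker) : D (s * n) t = D s t := by
    have hn : t⁻¹ * n * t ∈ f.toMonoidHom.ker := by
      simpa using (inferInstance : f.toMonoidHom.ker.Normal).conj_mem n n.2 t⁻¹
    have h1 := hbψ (s * t) ⟨t⁻¹ * n * t, hn⟩
    rw [h1Inv_apply_conj ψ t n hn, show s * t * (t⁻¹ * n * t) = s * n * t by group] at h1
    simp only [D, h1, hbψ]
    ring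
  have hD {s s' t t' : S} (hs : f s = f s') (ht : f t = f t') : D s t = D s' t' := by
    have hs' : s'⁻¹ * s ∈ f.toMonoidHom.ker := f.toMonoidHom.eq_iff.1 hs
    have ht' : t'⁻¹ * t ∈ f.toMonoidHom.ker := f.toMonoidHom.eq_iff.1 ht
    have h1 := hDl s' t ⟨_, hs'⟩
    have h2 := hDr s' t' ⟨_, ht'⟩
    simp only [mul_inv_cancel_left] at h1 h2
    rw [h1, h2]
  let σ : Q → S := Function.surjInv hf
  have hσ (x : Q) : f (σ x) = x := Function.surjInv_eq hf x
  have he (s t : S) : D (σ (f s)) (σ (f t)) = D s t := hD (hσ _) (hσ _)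
  refine ⟨b, fun x y => D (σ x) (σ y), hb, ⟨?_, fun x y z => ?_⟩, fun s t => ?_, hbψ⟩
  · have hq : Topology.IsQuotientMap (Prod.map f f) :=
      (f.continuous.prodMap f.continuous).isClosedMap.isQuotientMap
        (f.continuous.prodMap f.continuous) (hf.prodMap hf)
    refine hq.continuous_iff.2 ?_
    have : (fun x : Q × Q => D (σ x.1) (σ x.2)) ∘ Prod.map f f = fun x : S × S => D x.1 x.2 :=
      funext fun x => he x.1 x.2
    rw [this]
    fun_prop
  · obtain ⟨s, rfl⟩ := hf x
    obtain ⟨t, rfl⟩ := hf y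
    obtain ⟨r, rfl⟩ := hf z
    simp only [← map_mul, he]
    simp only [D, mul_assoc]
    ring
  · change _ = _ + D (σ (f s)) (σ (f t))
    rw [he]
    simp only [D]
    ring

variable {Γ : Type u} [Group Γ] [TopologicalSpace Γ] [IsTopologicalGroup Γ]
  [IsTopologicalGroup Q]

theorem inf2_surjective_iff_resH1_surjective [CompactSpace S] [TotallyDisconnectedSpace S]
    [CompactSpace Γ] [T2Space Γ] [CompactSpace Q] [T2Space Q] {π : S →ₜ* Γ} {φ : Γ →ₜ* Q}
    (hπ : Function.Surjective π) (hφ : Function.Surjective φ)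
    (hS : ∀ c : S → S → ZMod q, IsCocycle c →
      ∃ b : S → ZMod q, Continuous b ∧ ∀ s t, b (s * t) = b s + b t + c s t)
    (hle : π.toMonoidHom.ker ≤ (φ.comp π).toMonoidHom.ker) :
    Function.Surjective (inf2 q φ) ↔ Function.Surjective (resH1 q hle) := by
  rw [inf2_surjective_iff]
  have hφπ : Function.Surjective (φ.comp π) := hφ.comp hπ
  constructor
  · intro h ψ
    obtain ⟨b, c, hb, hc, hbc, hbψ⟩ := exists_cocycle_of_h1Inv hπ ψ
    obtain ⟨e, he, a, ha, hce⟩ := h c hc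
    -- The function b + a∘π has coboundary inflated from Q, hence shifts along T by a character. On
    -- R the term a∘π is constant, so this character restricts to ψ.
    obtain ⟨χ, hχ⟩ := exists_h1Inv_of_cocycle (f := φ.comp π) he
      (b := fun s => b s + a (π s)) (hb.add (ha.comp π.continuous)) fun s t => by
        rw [hbc, hce, map_mul]
        change _ = _ + e (φ (π s)) (φ (π t))
        ring
    refine ⟨χ, Subtype.ext (ContinuousMonoidHom.ext fun r => Multiplicative.toAdd.injective ?_)⟩
    have h1 := hχ 1 (Subgroup.inclusion hle r)
    have hr : π r = 1 := r.2
    have h2 := hbψ 1 r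
    simp only [Subgroup.coe_inclusion, one_mul, map_one, hr] at h1 h2
    change (χ.1 (Subgroup.inclusion hle r)).toAdd = _
    linear_combination h2 - h1
  · intro h c hc
    obtain ⟨b, hb, hbc⟩ := hS _ (hc.comp π)
    obtain ⟨ψ, hψ⟩ := exists_h1Inv_of_cocycle hc hb hbc
    obtain ⟨χ, rfl⟩ := h ψ
    obtain ⟨b', e, hb', he, hbe, hχ⟩ := exists_cocycle_of_h1Inv hφπ χ
    -- Both b' and b shift along R by the restriction of χ, so b' - b descends to Γ. There it is the
    -- cochain whose coboundary is the difference of c and the inflation of e.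
    have hinv {s t : S} (hst : π s = π t) : b' s - b s = b' t - b t := by
      have hm : t⁻¹ * s ∈ π.toMonoidHom.ker := π.toMonoidHom.eq_iff.1 hst
      have h1 := hψ t ⟨_, hm⟩
      have h2 : b' (t * (t⁻¹ * s)) = b' t + _ := hχ t (Subgroup.inclusion hle ⟨_, hm⟩)
      simp only [mul_inv_cancel_left] at h1 h2
      rw [h1, h2]
      change _ - (_ + (χ.1 (Subgroup.inclusion hle ⟨_, hm⟩)).toAdd) = _
      ring
    let σ : Γ → S := Function.surjInv hπ
    have hσ (s : S) : b' (σ (π s)) - b (σ (π s)) = b' s - b s :=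
      hinv (Function.surjInv_eq hπ _)
    refine ⟨e, he, fun x => b' (σ x) - b (σ x), ?_, fun x y => ?_⟩
    · refine (π.continuous.isClosedMap.isQuotientMap π.continuous hπ).continuous_iff.2 ?_
      exact (hb'.sub hb).congr fun s => (hσ s).symm
    · obtain ⟨s, rfl⟩ := hπ x
      obtain ⟨t, rfl⟩ := hπ y
      rw [← map_mul π]
      change _ = _ + (b' (σ (π s)) - b (σ (π s)) + (b' (σ (π t)) - b (σ (π t))) -
        (b' (σ (π (s * t))) - b (σ (π (s * t)))))
      rw [hσ, hσ, hσ, hbc, hbe]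
      change _ = e (φ (π s)) (φ (π t)) + (_ - (_ + _ + e (φ (π s)) (φ (π t)) - _))
      ring

end Transgression

/-! ### Closedness of the kernels, and surjectivity of φ -/

section MaxProPQuotient

variable (p : ℕ) (G : Type u) [Group G] [TopologicalSpace G] [IsTopologicalGroup G]

theorem isClosed_proPKernel : IsClosed (proPKernel p G : Set G) := by
  rw [proPKernel, Subgroup.coe_iInf]
  exact isClosed_iInter fun U => U.1.toOpenSubgroup.isClosed

theorem isClosed_qCentral (q : ℕ) : ∀ i, IsClosed (qCentral G q i : Set G)
  | 0 => isClosed_univ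
  | 1 => isClosed_univ
  | _ + 2 => Subgroup.isClosed_topologicalClosure _

theorem phi_surjective [CompactSpace G] [TotallyDisconnectedSpace G] (d : ℕ) :
    Function.Surjective (phi p G d) := fun x => by
  obtain ⟨g, rfl⟩ := QuotientGroup.mk_surjective x
  exact ⟨g, phi_mk p G d g⟩

end MaxProPQuotient

end QCentral

open QCentral in
theorem theorem7p1 (p d : ℕ) [Fact p.Prime] (hd : 1 ≤ d)
    (G : Type u) [Group G] [TopologicalSpace G] [IsTopologicalGroup G] [CompactSpace G]
    [TotallyDisconnectedSpace G]
    (S : Type v) [Group S] [TopologicalSpace S] [IsTopologicalGroup S] [CompactSpace S]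
    [TotallyDisconnectedSpace S] (hS : IsFreeProP p S)
    (π : S →ₜ* MaxProPQuotient p G) (hπ : Function.Surjective π) :
    List.TFAE [
      Function.Surjective (inf2 (p ^ d) (phi p G d)),
      Function.Surjective (resH1 (p ^ d) (kerR_le_kerT d π)),
      Function.Injective (powCommQuotientMap (p ^ d) (kerR_le_kerT d π)),
      powComm (p ^ d) (kerR π) = kerR π ⊓ powComm (p ^ d) (kerT d π)] := by
  -- These two facts let instance search find that G(p) and G^[2] are Hausdorff.
  have hΓ : IsClosed (proPKernel p G : Set G) := isClosed_proPKernel p G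
  have hQ : IsClosed (qCentral G (p ^ d) 2 : Set G) := isClosed_qCentral G (p ^ d) 2
  have hR : IsClosed (kerR π : Set S) := isClosed_singleton.preimage π.continuous
  have hT : IsClosed (kerT d π : Set S) :=
    isClosed_singleton.preimage ((phi p G d).comp π).continuous
  tfae_have 1 ↔ 2 := inf2_surjective_iff_resH1_surjective hπ (phi_surjective p G d)
    (fun _ => hS.exists_splitting) _
  tfae_have 2 ↔ 3 :=
    (resH1_surjective_iff hR hT _).trans (powCommQuotientMap_injective_iff _).symm
  tfae_have 3 ↔ 4 := by
    rw [powCommQuotientMap_injective_iff]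
    exact ⟨fun h => le_antisymm (le_inf (powComm_le _ hR) (powComm_mono _ (kerR_le_kerT d π))) h,
      fun h => h.ge⟩
  tfae_finish
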